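/- **Setting.** A *Lawverian quantale* $(\Omega,\le,\otimes,k)$ is a complete lattice with a commutative monoid structure such that $\otimes$ distributes over arbitrary joins, $k=\top$, $k\neq\bot$, and $\varepsilon\otimes\delta=\bot$ implies $\varepsilon=\bot$ or $\delta=\bot$. A *change of base endofunctor* (CBE) is a monotone map $\phi:\Omega\to\Omega$ with $\phi(k)=k$, $\phi(\varepsilon\otimes\delta)=\phi(\varepsilon)\otimes\phi(\delta)$, and $\phi(\bigvee_i\varepsilon_i)=\bigvee_i\phi(\varepsilon_i)$ for non-empty families. Let $\Phi$ be a set of CBEs that contains the identity and the constant map $k^\star:\varepsilon\mapsto k$ and is closed under composition and pointwise tensor. For a map $R:A\times A\to\Omega$ put $R^-(a,b)=R(b,a)$ and $(R;S)(a,c)=\bigvee_b R(a,b)\otimes S(b,c)$; let $\Delta(a,b)$ be $k$ if $a=b$ and $\bot$ otherwise, $R^0=\Delta$, $R^{n+1}=R;R^n$, $R^*=\bigvee_n R^n$. Then $R$ is *confluent* if $R^{*-};R^*\le R^*;R^{*-}$; *locally confluent* if $R^-;R\le R^*;R^{*-}$; *locally confluent on* $(a,b)$ if $(R^-;R)(a,b)\le(R^*;R^{*-})(a,b)$;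 *terminating* if there is no infinite sequence $a_0,a_1,\dots$ with $R(a_n,a_{n+1})\neq\bot$ for all $n$. A *$(\Omega,\Phi)$-TRS* consists of a signature in which every $n$-ary symbol $f$ has a modal arity $(\phi_1,\dots,\phi_n)\in\Phi^n$, and a set of rules $\varepsilon\Vdash a\mapsto b$, with $\varepsilon\in\Omega$ and $a,b$ terms over an infinite set of variables. The grade $\partial_{\mathcal C}$ of a one-hole context is defined by $\partial_{\square}=\mathrm{id}$ and $\partial_{f(\dots,\mathcal C,\dots)}=\phi_i\circ\partial_{\mathcal C}$ ($\mathcal C$ in the $i$-th argument). The grade of a variable in a term is defined by $\partial_x(x)=\mathrm{id}$, $\partial_x(y)=k^\star$ for $y\ne x$, and $\partial_x(f(e_1,\dots,e_n))=\bigotimes_i\phi_i\circ\partial_x(e_i)$. The relation $\varepsilon\Vdash e\to f$ is generated by: $\partial_{\mathcal C}(\varepsilon)\Vdash \mathcal C[a^\sigma]\to\mathcal C[b^\sigma]$ if $\varepsilon\Vdash a\mapsto b$; and $\delta\Vdash e\to f$ if $\varepsilon\Vdash e\to f$ and $\delta\le\varepsilon$. Put $R(e,f)=\bigvee\{\varepsilon\mid\varepsilon\Vdash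 e\to f\}$. The system is *balanced* if $\partial_x(a)=\partial_x(b)$ for every rule $\varepsilon\Vdash a\mapsto b$ and every variable $x$, and *left-linear* if no variable occurs more than once in the left-hand side of a rule. A *critical pair* arises from renamings $c_1\mapsto d_1$, $c_2\mapsto d_2$ of two rules without common variables, a decomposition $c_2=\mathcal D[u]$ with $u$ not a variable, and a most general unifier $\sigma$ of $c_1$ and $u$, where the two rules (disregarding their distances) are not variants of each other if $\mathcal D=\square$; it is the pair $(\mathcal D^\sigma[d_1^\sigma],\,d_2^\sigma)$. **Theorem.** Let $\mathcal R$ be a balanced, left-linear $(\Omega,\Phi)$-TRS. Assume that contexts never turn the distance $\bot$ (no reduction) into a reduction: for all terms $a,b$ and contexts $\mathcal C,\mathcal D$, if $\partial_{\mathcal D}(\varepsilon)=\bot$ for every rule $\varepsilon\Vdash a\mapsto b$, then $\partial_{\mathcal C}(\partial_{\mathcal D}(\varepsilon))=\bot$ for every such rule. Suppose that $R$ is locally confluent on every critical pair of $\mathcal R$. 1. (Critical Pair Lemma) If every variable of the right-hand side of each rule occurs in its left-hand side, then $R$ is locally confluent. 2. (Critical Pair Theorem) If $R$ is terminating, then $R$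 is confluent. -/

import Mathlib

/-! ### Quantales, change of base functors, and `Ω`-valued relations -/

/-- A Lawverian quantale: a commutative unital quantale that is integral, non-trivial and
cointegral. The tensor is `*`, its unit is `1`. -/
class IsLawverian (Ω : Type*) [CommMonoid Ω] [CompleteLattice Ω] [IsQuantale Ω] : Prop where
  one_eq_top : (1 : Ω) = ⊤
  one_ne_bot : (1 : Ω) ≠ ⊥
  eq_bot_or_eq_bot : ∀ x y : Ω, x * y = ⊥ → x = ⊥ ∨ y = ⊥

/-- Change of base endofunctors of a quantale: monotone maps that preserve the unit, the tensor
and all non-empty joins. The empty join is left out: the constant map `1`, which every grading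
structure contains, does not send `⊥` to `⊥`. -/
structure IsCBE {Ω : Type*} [CommMonoid Ω] [CompleteLattice Ω] (φ : Ω → Ω) : Prop where
  mono : Monotone φ
  map_one : φ 1 = 1
  map_mul : ∀ x y, φ (x * y) = φ x * φ y
  map_sSup : ∀ s : Set Ω, s.Nonempty → φ (sSup s) = sSup (φ '' s)

/-- A set `Φ` of change of base endofunctors containing the identity and the constant unit map and
closed under composition and pointwise tensor. -/
structure GradeSystem (Ω : Type*) [CommMonoid Ω] [CompleteLattice Ω] where
  carrier : Set (Ω → Ω)
  isCBE : ∀ φ ∈ carrier, IsCBE φ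
  id_mem : id ∈ carrier
  const_one_mem : (fun _ => 1) ∈ carrier
  comp_mem : ∀ φ ∈ carrier, ∀ ψ ∈ carrier, φ ∘ ψ ∈ carrier
  mul_mem : ∀ φ ∈ carrier, ∀ ψ ∈ carrier, (fun x => φ x * ψ x) ∈ carrier

namespace QRel

variable {Ω A : Type*} [CommMonoid Ω] [CompleteLattice Ω]

open Classical in
/-- The identity `Ω`-relation. -/
noncomputable def diag : A → A → Ω := fun a b => if a = b then 1 else ⊥

/-- Composition `R ; S` of `Ω`-relations. -/
def comp (R S : A → A → Ω) : A → A → Ω := fun a c => ⨆ b, R a b * S b c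

/-- The transpose of an `Ω`-relation. -/
def dual (R : A → A → Ω) : A → A → Ω := fun a b => R b a

/-- The iterates `R ^ n` of an `Ω`-relation. -/
noncomputable def iter (R : A → A → Ω) : ℕ → A → A → Ω
  | 0 => diag
  | n + 1 => comp R (iter R n)

/-- The reflexive and transitive closure `R*`. -/
noncomputable def star (R : A → A → Ω) : A → A → Ω := fun a b => ⨆ n, iter R n a b

/-- `R` has the diamond property: `R⁻ ; R ≤ R ; R⁻`. -/
def Diamond (R : A → A → Ω) : Prop := comp (dual R) R ≤ comp R (dual R)

/-- `R` is confluent: `R*` has the diamond property. -/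
def Confluent (R : A → A → Ω) : Prop := Diamond (star R)

/-- `R` is locally confluent on the pair `(a, b)`: `(R⁻ ; R)(a, b) ≤ (R* ; R*⁻)(a, b)`. -/
def LocallyConfluentAt (R : A → A → Ω) (a b : A) : Prop :=
  comp (dual R) R a b ≤ comp (star R) (dual (star R)) a b

/-- `R` is locally confluent: `R⁻ ; R ≤ R* ; R*⁻`. -/
def LocallyConfluent (R : A → A → Ω) : Prop :=
  comp (dual R) R ≤ comp (star R) (dual (star R))

/-- `R` is terminating (strongly normalising): there is no infinite reduction sequence, where `a`
reduces to `b` when `R a b ≠ ⊥`. -/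
def Terminating (R : A → A → Ω) : Prop :=
  ¬ ∃ u : ℕ → A, ∀ n, R (u n) (u (n + 1)) ≠ ⊥

end QRel

/-! ### Terms and contexts -/

/-- One-hole contexts. In `Ctx.func f i ts C` the `i`-th argument of `f` is `C`, the `j`-th argument
with `j ≠ i` is `ts j`, and the value `ts i` is ignored. -/
inductive Ctx (L : FirstOrder.Language) (X : Type*)
  | hole : Ctx L X
  | func {n : ℕ} (f : L.Functions n) (i : Fin n) (ts : Fin n → L.Term X) (C : Ctx L X) : Ctx L X

namespace Ctx

variable {L : FirstOrder.Language} {X : Type*}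

/-- `C.plug e` is the term `C[e]`. -/
def plug : Ctx L X → L.Term X → L.Term X
  | hole, e => e
  | func f i ts C, e => .func f (Function.update ts i (C.plug e))

/-- The instance `C^σ` of a context. -/
def subst : Ctx L X → (X → L.Term X) → Ctx L X
  | hole, _ => hole
  | func f i ts C, σ => func f i (fun j => (ts j).subst σ) (C.subst σ)

end Ctx

open Classical in
/-- The number of occurrences of the variable `x` in a term. -/
noncomputable def occ {L : FirstOrder.Language} {X : Type*} (x : X) : L.Term X → ℕ
  | .var y => if y = x then 1 else 0
  | .func _ ts => ∑ i, occ x (ts i)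

/-- A term is linear if no variable occurs in it more than once. -/
def IsLinearTerm {L : FirstOrder.Language} {X : Type*} (e : L.Term X) : Prop :=
  ∀ x, occ x e ≤ 1

/-- `σ` is a most general unifier of `s` and `t`: it unifies them, and every unifier is obtained by
first applying `σ` and then some substitution `ρ`. -/
def IsMGU {L : FirstOrder.Language} {X : Type*} (σ : X → L.Term X) (s t : L.Term X) : Prop :=
  s.subst σ = t.subst σ ∧
    ∀ τ : X → L.Term X, s.subst τ = t.subst τ → ∃ ρ : X → L.Term X, ∀ x, τ x = (σ x).subst ρ

/-! ### Graded term rewriting systems -/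

/-- A `(Ω, Φ)`-term rewriting system over the variables `X`: a signature whose `n`-ary function
symbols carry a modal arity, that is, an `n`-tuple of elements of `Φ`, and a ternary relation
`rule ε a b` on terms, read as the rewrite rule `ε ⊩ a ↦ b`. -/
structure GradedTRS (Ω : Type*) [CommMonoid Ω] [CompleteLattice Ω] (Φ : GradeSystem Ω)
    (L : FirstOrder.Language) (X : Type*) where
  grade : ∀ {n : ℕ}, L.Functions n → Fin n → Ω → Ω
  grade_mem : ∀ {n : ℕ} (f : L.Functions n) (i : Fin n), grade f i ∈ Φ.carrier
  rule : Ω → L.Term X → L.Term X → Prop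

namespace GradedTRS

variable {Ω : Type*} [CommMonoid Ω] [CompleteLattice Ω] {Φ : GradeSystem Ω}
  {L : FirstOrder.Language} {X : Type*}

open Classical in
/-- The grade of the variable `x` in a term. -/
noncomputable def varGrade (T : GradedTRS Ω Φ L X) (x : X) : L.Term X → Ω → Ω
  | .var y => if y = x then id else fun _ => 1
  | .func f ts => fun ε => ∏ i, T.grade f i (T.varGrade x (ts i) ε)

/-- The grade of the hole in a context. -/
def ctxGrade (T : GradedTRS Ω Φ L X) : Ctx L X → Ω → Ω
  | .hole => id
  | .func f i _ C => T.grade f i ∘ T.ctxGrade C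

/-- The rewriting relation `ε ⊩ e → f` generated by the rules: closure under graded contexts and
substitution, and weakening. -/
inductive Step (T : GradedTRS Ω Φ L X) : Ω → L.Term X → L.Term X → Prop
  | rule {ε : Ω} {a b : L.Term X} (h : T.rule ε a b) (C : Ctx L X) (σ : X → L.Term X) :
      Step T (T.ctxGrade C ε) (C.plug (a.subst σ)) (C.plug (b.subst σ))
  | weaken {ε δ : Ω} {e f : L.Term X} (h : Step T ε e f) (hδ : δ ≤ ε) : Step T δ e f

/-- The rewriting `Ω`-relation `R(e, f) = ⋁ {ε | ε ⊩ e → f}` induced by the system. -/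
def R (T : GradedTRS Ω Φ L X) : L.Term X → L.Term X → Ω :=
  fun e f => sSup {ε | T.Step ε e f}

/-- Every variable has the same grade in both sides of each rule. -/
def Balanced (T : GradedTRS Ω Φ L X) : Prop :=
  ∀ ε a b, T.rule ε a b → ∀ x, T.varGrade x a = T.varGrade x b

/-- The left-hand side of each rule is linear. -/
def LeftLinear (T : GradedTRS Ω Φ L X) : Prop :=
  ∀ ε a b, T.rule ε a b → IsLinearTerm a

/-- The variables of the right-hand side of each rule occur in its left-hand side. -/
def NoExtraVariables (T : GradedTRS Ω Φ L X) : Prop :=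
  ∀ ε a b, T.rule ε a b → ∀ x, occ x b ≠ 0 → occ x a ≠ 0

/-- Distance `⊥` means that there is no reduction. This condition says that a rule which yields only
the distance `⊥` in a context `D` still yields only `⊥` in each larger context `C[D]`. -/
def BotStable (T : GradedTRS Ω Φ L X) : Prop :=
  ∀ (a b : L.Term X) (C D : Ctx L X), (∀ ε, T.rule ε a b → T.ctxGrade D ε = ⊥) →
    ∀ ε, T.rule ε a b → T.ctxGrade C (T.ctxGrade D ε) = ⊥

/-- `(t, s)` is a critical pair. Two rules are renamed by `π₁`, `π₂` to `c₁ ↦ d₁` and `c₂ ↦ d₂`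
without common variables; `c₂ = D[u]`, where `u` is not a variable (so that the position of the hole
of `D` is a function symbol position of `c₂`), `σ` is a most general unifier of `c₁` and `u`, and if
`D` is the empty context then the rules are not variants of each other. The pair is
`(c₂^σ[d₁^σ], d₂^σ)`. -/
def IsCriticalPair (T : GradedTRS Ω Φ L X) (t s : L.Term X) : Prop :=
  ∃ (ε δ : Ω) (a₁ b₁ a₂ b₂ : L.Term X) (π₁ π₂ : Equiv.Perm X) (c₁ d₁ c₂ d₂ : L.Term X),
    T.rule ε a₁ b₁ ∧ T.rule δ a₂ b₂ ∧
    c₁ = a₁.relabel π₁ ∧ d₁ = b₁.relabel π₁ ∧ c₂ = a₂.relabel π₂ ∧ d₂ = b₂.relabel π₂ ∧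
    (∀ x, ¬ ((occ x c₁ ≠ 0 ∨ occ x d₁ ≠ 0) ∧ (occ x c₂ ≠ 0 ∨ occ x d₂ ≠ 0))) ∧
    ∃ (D : Ctx L X) (u : L.Term X) (σ : X → L.Term X),
      c₂ = D.plug u ∧ (∀ x, u ≠ .var x) ∧ IsMGU σ c₁ u ∧
      (D = .hole → ¬ ∃ π : Equiv.Perm X, c₂ = c₁.relabel π ∧ d₂ = d₁.relabel π) ∧
      t = (D.subst σ).plug (d₁.subst σ) ∧ s = d₂.subst σ

end GradedTRS

/-!
Newman's lemma holds for `Ω`-relations by the usual well-founded induction, and a terminating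
balanced system has no extra variables: if `x` occurs in `b = F[x]` but not in `a`, then balance
forces `F` to have the constant grade `1`, and `a` reduces to an instance of `F[a]`, for ever
(`GradedTRS.noExtraVariables_of_terminating`). So everything rests on local confluence, that is, on
bounding the tensor of the distances of two steps from the same term by the degree
`QRel.join T.R s t` to which their results are joinable (`GradedTRS.peak_le_join`).

Steps at disjoint positions commute. Otherwise one redex lies inside the other one.

* If it lies below a variable `x` of the outer left-hand side (`GradedTRS.variable_overlap_le_join`),
  all occurrences of `x` in the right-hand side have to be reduced. The tensor of the grades of these
  reductions is the grade of `x` in the right-hand side. By balance this is the grade of `x` in the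
  left-hand side, which by linearity is the grade of the position of `x`.
* Otherwise (`GradedTRS.critical_overlap`) the peak is an instance of a critical pair, placed in a
  context, or both results coincide. As left-hand sides are linear, and the two rules are renamed
  apart, the most general unifier is found by structural recursion (`exists_mgu_of_linear`).

The delicate point is the passage to a surrounding context `C`. Its grade preserves non-empty joins
only, so that it preserves the joinability of a pair as long as that is not `⊥`
(`GradedTRS.ctxGrade_join_le`). If it is `⊥`, cointegrality makes one of the two rules yield only `⊥`,
and this persists in `C` by hypothesis (`GradedTRS.BotStable.peak_le_join`). Reductions given by
explicit sequences of steps, `GradedTRS.MultiStep`, pass into contexts without this restriction.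
-/

/-! ### Terms and substitutions -/

section Terms

open FirstOrder Language

variable {L : FirstOrder.Language} {X : Type*}

theorem occ_func_ne_zero {x : X} {n : ℕ} {f : L.Functions n} {ts : Fin n → L.Term X} :
    occ x (Term.func f ts) ≠ 0 ↔ ∃ i, occ x (ts i) ≠ 0 := by
  simp [occ]

theorem occ_le_occ_func (x : X) {n : ℕ} (f : L.Functions n) (ts : Fin n → L.Term X) (i : Fin n) :
    occ x (ts i) ≤ occ x (Term.func f ts) := by
  rw [occ]
  exact Finset.single_le_sum (f := fun i => occ x (ts i)) (fun _ _ => Nat.zero_le _)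
    (Finset.mem_univ i)

theorem occ_var_self_ne_zero (x : X) : occ x (Term.var x : L.Term X) ≠ 0 := by
  simp [occ]

theorem eq_of_occ_var_ne_zero {x y : X} (h : occ x (Term.var y : L.Term X) ≠ 0) : y = x := by
  by_contra hne
  simp [occ, hne] at h

theorem IsLinearTerm.arg {n : ℕ} {f : L.Functions n} {ts : Fin n → L.Term X}
    (h : IsLinearTerm (Term.func f ts)) (i : Fin n) : IsLinearTerm (ts i) :=
  fun x => (occ_le_occ_func x f ts i).trans (h x)

theorem IsLinearTerm.arg_unique {n : ℕ} {f : L.Functions n} {ts : Fin n → L.Term X}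
    (h : IsLinearTerm (Term.func f ts)) {x : X} {i j : Fin n} (hi : occ x (ts i) ≠ 0)
    (hj : occ x (ts j) ≠ 0) : i = j := by
  by_contra hij
  have h1 := h x
  rw [occ] at h1
  have h2 : ∑ k ∈ ({i, j} : Finset (Fin n)), occ x (ts k) ≤ ∑ k, occ x (ts k) :=
    Finset.sum_le_sum_of_subset (Finset.subset_univ _)
  rw [Finset.sum_pair hij] at h2
  omega

theorem finite_setOf_occ_ne_zero (e : L.Term X) : {x | occ x e ≠ 0}.Finite := by
  induction e with
  | var y => exact (Set.finite_singleton y).subset fun x hx => (eq_of_occ_var_ne_zero hx).symm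
  | func f ts ih =>
    refine (Set.finite_iUnion ih).subset fun x hx => ?_
    simpa using occ_func_ne_zero.1 hx

theorem subst_eq_subst_iff {σ τ : X → L.Term X} {e : L.Term X} :
    e.subst σ = e.subst τ ↔ ∀ x, occ x e ≠ 0 → σ x = τ x := by
  induction e with
  | var y =>
    refine ⟨fun h x hx => ?_, fun h => h y (occ_var_self_ne_zero y)⟩
    rw [← eq_of_occ_var_ne_zero hx]
    exact h
  | func f ts ih =>
    simp only [Term.subst, Term.func.injEq, heq_eq_eq, true_and, funext_iff, ih,
      occ_func_ne_zero]
    exact ⟨fun h x ⟨i, hi⟩ => h i x hi, fun h i x hi => h x ⟨i, hi⟩⟩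

theorem subst_subst (e : L.Term X) (σ τ : X → L.Term X) :
    (e.subst σ).subst τ = e.subst fun x => (σ x).subst τ := by
  induction e with
  | var y => rfl
  | func f ts ih => simp only [Term.subst, ih]

theorem subst_relabel (e : L.Term X) (g : X → X) (σ : X → L.Term X) :
    (e.relabel g).subst σ = e.subst (σ ∘ g) := by
  induction e with
  | var y => rfl
  | func f ts ih => simp only [Term.subst, Term.relabel, ih]

theorem subst_var (e : L.Term X) : e.subst Term.var = e := by
  induction e with
  | var y => rfl
  | func f ts ih => simp only [Term.subst, ih]

theorem occ_relabel (e : L.Term X) (π : Equiv.Perm X) (x : X) :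
    occ x (e.relabel π) = occ (π.symm x) e := by
  induction e with
  | var y =>
    have h : y = π.symm x ↔ π y = x := π.eq_symm_apply
    by_cases hy : π y = x
    · simp [Term.relabel, occ, h.2 hy]
    · simp [Term.relabel, occ, hy, h.not.2 hy]
  | func f ts ih => simp only [Term.relabel, occ, ih]

theorem IsLinearTerm.relabel {e : L.Term X} (h : IsLinearTerm e) (π : Equiv.Perm X) :
    IsLinearTerm (e.relabel π) := fun x => (occ_relabel e π x).trans_le (h _)

/-- Two unifiable linear terms without common variables have an idempotent most general unifier.
Linearity makes unification structural: the argument pairs of `f(s₁,…)` and `f(t₁,…)` have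
pairwise disjoint variables, so their unifiers are glued together without any interaction. -/
theorem exists_mgu_of_linear (s : L.Term X) : ∀ t : L.Term X, IsLinearTerm s → IsLinearTerm t →
    (∀ x, occ x s ≠ 0 → occ x t = 0) → (∃ τ : X → L.Term X, s.subst τ = t.subst τ) →
    ∃ σ : X → L.Term X, s.subst σ = t.subst σ ∧
      ∀ τ : X → L.Term X, s.subst τ = t.subst τ → ∀ x, τ x = (σ x).subst τ := by
  classical
  -- a variable is unified with a term not containing it by substituting that term
  have key (y : X) (t : L.Term X) (h : occ y t = 0) : ∃ σ : X → L.Term X,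
      (Term.var y).subst σ = t.subst σ ∧
      ∀ τ : X → L.Term X, (Term.var y).subst τ = t.subst τ → ∀ x, τ x = (σ x).subst τ := by
    refine ⟨Function.update Term.var y t, ?_, fun τ hτ x => ?_⟩
    · have : t.subst (Function.update Term.var y t) = t.subst Term.var :=
        subst_eq_subst_iff.2 fun x hx => Function.update_of_ne (by rintro rfl; exact hx h) _ _
      rw [this, subst_var]
      exact Function.update_self ..
    · obtain rfl | hx := eq_or_ne x y
      · rw [Function.update_self]
        exact hτ
      · rw [Function.update_of_ne hx]
        rfl
  induction s with
  | var y => exact fun t _ _ hst _ => key y t (hst y (occ_var_self_ne_zero y))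
  | func f ss ih =>
    rintro (y | ⟨g, ts⟩) hs ht hst ⟨τ₀, hτ₀⟩
    · have hy : occ y (Term.func f ss) = 0 := by
        by_contra h
        exact occ_var_self_ne_zero y (hst y h)
      obtain ⟨σ, h1, h2⟩ := key y _ hy
      exact ⟨σ, h1.symm, fun τ hτ => h2 τ hτ.symm⟩
    · simp only [Term.subst, Term.func.injEq] at hτ₀
      obtain ⟨rfl, hfg, hts⟩ := hτ₀
      obtain rfl := eq_of_heq hfg
      have harg (i) := ih i (ts i) (hs.arg i) (ht.arg i)
        (fun x hx => by
          by_contra h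
          exact occ_func_ne_zero.2 ⟨i, h⟩ (hst x (occ_func_ne_zero.2 ⟨i, hx⟩)))
        ⟨τ₀, congrFun (eq_of_heq hts) i⟩
      choose σ hσ hmgu using harg
      -- the argument position at which a variable occurs, on either side, is unique
      have huniq {x : X} {i j} (hi : occ x (ss i) ≠ 0 ∨ occ x (ts i) ≠ 0)
          (hj : occ x (ss j) ≠ 0 ∨ occ x (ts j) ≠ 0) : i = j := by
        rcases hi with hi | hi <;> rcases hj with hj | hj
        · exact hs.arg_unique hi hj
        · exact absurd (hst x (occ_func_ne_zero.2 ⟨i, hi⟩)) (occ_func_ne_zero.2 ⟨j, hj⟩)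
        · exact absurd (hst x (occ_func_ne_zero.2 ⟨j, hj⟩)) (occ_func_ne_zero.2 ⟨i, hi⟩)
        · exact ht.arg_unique hi hj
      let σ' : X → L.Term X := fun x =>
        if h : ∃ i, occ x (ss i) ≠ 0 ∨ occ x (ts i) ≠ 0 then σ h.choose x else Term.var x
      have hσ' {x : X} {i} (hi : occ x (ss i) ≠ 0 ∨ occ x (ts i) ≠ 0) : σ' x = σ i x := by
        have h : ∃ i, occ x (ss i) ≠ 0 ∨ occ x (ts i) ≠ 0 := ⟨i, hi⟩
        simp only [σ', dif_pos h, huniq h.choose_spec hi]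
      refine ⟨σ', ?_, fun τ hτ x => ?_⟩
      · simp only [Term.subst, Term.func.injEq, heq_eq_eq, true_and]
        funext i
        rw [subst_eq_subst_iff.2 fun x hx => hσ' (Or.inl hx),
          subst_eq_subst_iff.2 fun x hx => hσ' (Or.inr hx)]
        exact hσ i
      · simp only [Term.subst, Term.func.injEq, heq_eq_eq, true_and] at hτ
        by_cases h : ∃ i, occ x (ss i) ≠ 0 ∨ occ x (ts i) ≠ 0
        · obtain ⟨i, hi⟩ := h
          rw [hσ' hi]
          exact hmgu i τ (congrFun hτ i) x
        · simp only [σ', dif_neg h]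
          rfl

/-- Finitely many variables can be renamed away from any finite set of variables. -/
theorem exists_perm_disjoint [Infinite X] {U V : Set X} (hU : U.Finite) (hV : V.Finite) :
    ∃ π : Equiv.Perm X, ∀ x ∈ V, π x ∉ U := by
  classical
  obtain ⟨W, hWU, hW⟩ := hU.infinite_compl.exists_subset_card_eq hV.toFinset.card
  have hp := Equiv.Perm.isMultiplyPretransitive X hV.toFinset.card
  let v : Fin hV.toFinset.card ↪ X :=
    (hV.toFinset.equivFin.symm.toEmbedding).trans (Function.Embedding.subtype _)
  let w : Fin hV.toFinset.card ↪ X :=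
    ((finCongr hW.symm).trans W.equivFin.symm).toEmbedding.trans (Function.Embedding.subtype _)
  obtain ⟨π, hπ⟩ := MulAction.IsPretransitive.exists_smul_eq (M := Equiv.Perm X) v w
  refine ⟨π, fun x hx => ?_⟩
  let i := hV.toFinset.equivFin ⟨x, hV.mem_toFinset.2 hx⟩
  have hv : v i = x := by simp [v, i]
  have h := DFunLike.congr_fun hπ i
  rw [Function.Embedding.smul_apply, hv, Equiv.Perm.smul_def] at h
  rw [h]
  exact hWU (Subtype.prop _)

end Terms

/-! ### Contexts and positions -/

section Contexts

open FirstOrder Language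

variable {L : FirstOrder.Language} {X : Type*}

/-- The composite context `C[D]`. -/
def Ctx.comp : Ctx L X → Ctx L X → Ctx L X
  | .hole, D => D
  | .func f i ts C, D => .func f i ts (C.comp D)

theorem Ctx.plug_comp (C D : Ctx L X) (e : L.Term X) :
    (C.comp D).plug e = C.plug (D.plug e) := by
  induction C with
  | hole => rfl
  | func f i ts C ih => simp only [Ctx.comp, Ctx.plug, ih]

theorem Ctx.plug_subst (C : Ctx L X) (e : L.Term X) (σ : X → L.Term X) :
    (C.plug e).subst σ = (C.subst σ).plug (e.subst σ) := by
  induction C with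
  | hole => rfl
  | func f i ts C ih =>
    simp only [Ctx.plug, Ctx.subst, Term.subst, Term.func.injEq, heq_eq_eq, true_and, ← ih]
    funext j
    obtain rfl | hj := eq_or_ne j i
    · simp
    · simp [hj]

theorem occ_le_occ_plug (x : X) (C : Ctx L X) (e : L.Term X) : occ x e ≤ occ x (C.plug e) := by
  induction C with
  | hole => exact le_rfl
  | func f i ts C ih =>
    refine ih.trans ?_
    have := occ_le_occ_func x f (Function.update ts i (C.plug e)) i
    rwa [Function.update_self] at this

theorem exists_ctx_of_occ_ne_zero {x : X} {e : L.Term X} (h : occ x e ≠ 0) :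
    ∃ C : Ctx L X, e = C.plug (.var x) := by
  induction e with
  | var y => exact ⟨.hole, by rw [eq_of_occ_var_ne_zero h]; rfl⟩
  | func f ts ih =>
    obtain ⟨i, hi⟩ := occ_func_ne_zero.1 h
    obtain ⟨C, hC⟩ := ih i hi
    exact ⟨.func f i ts C, by rw [Ctx.plug, ← hC, Function.update_eq_self]⟩

variable {Ω : Type*} [CommMonoid Ω] [CompleteLattice Ω] {Φ : GradeSystem Ω}

namespace GradedTRS

variable (T : GradedTRS Ω Φ L X)

theorem ctxGrade_comp (C D : Ctx L X) :
    T.ctxGrade (C.comp D) = T.ctxGrade C ∘ T.ctxGrade D := by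
  induction C with
  | hole => rfl
  | func f i ts C ih => simp only [Ctx.comp, ctxGrade, ih, Function.comp_assoc]

theorem ctxGrade_subst (C : Ctx L X) (σ : X → L.Term X) :
    T.ctxGrade (C.subst σ) = T.ctxGrade C := by
  induction C with
  | hole => rfl
  | func f i ts C ih => simp only [Ctx.subst, ctxGrade, ih]

/-- The hole of `D` lies below the hole of `C`, at the hole of `E`. The arguments of contexts that
are replaced by the hole are arbitrary, so that `D` and `C[E]` are compared through the terms and the
grades that they give. -/
structure IsBelow (D C E : Ctx L X) : Prop where
  plug_eq : ∀ e, D.plug e = C.plug (E.plug e)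
  grade_eq : T.ctxGrade D = T.ctxGrade C ∘ T.ctxGrade E

variable {T} in
theorem IsBelow.func {D C E : Ctx L X} (h : T.IsBelow D C E) {n : ℕ} (f : L.Functions n)
    (i : Fin n) {ts us : Fin n → L.Term X} {p q : L.Term X}
    (htu : Function.update ts i p = Function.update us i q) :
    T.IsBelow (.func f i us D) (.func f i ts C) E where
  plug_eq e := by
    have := congrArg (fun v => Function.update v i (C.plug (E.plug e))) htu
    simp only [Function.update_idem] at this
    simp only [Ctx.plug, h.plug_eq, this]
  grade_eq := by simp only [ctxGrade, h.grade_eq, Function.comp_assoc]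

/-- Two occurrences of subterms `p` and `q` in the same term are nested or disjoint. In the disjoint
case both can be replaced independently of each other. -/
theorem nested_or_disjoint (C : Ctx L X) : ∀ (D : Ctx L X) (p q : L.Term X),
    C.plug p = D.plug q →
    (∃ E, p = E.plug q ∧ T.IsBelow D C E) ∨ (∃ E, q = E.plug p ∧ T.IsBelow C D E) ∨
    ∀ p' q' : L.Term X, ∃ C' D' : Ctx L X, C.plug p' = D'.plug q ∧ D.plug q' = C'.plug p ∧
      D'.plug q' = C'.plug p' ∧ T.ctxGrade C' = T.ctxGrade C ∧ T.ctxGrade D' = T.ctxGrade D := by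
  induction C with
  | hole => exact fun D p q h => Or.inl ⟨D, h, ⟨fun _ => rfl, rfl⟩⟩
  | @func n f i ts C ih =>
    rintro (_ | ⟨g, j, us, D⟩) p q h
    · exact Or.inr (Or.inl ⟨.func f i ts C, h.symm, ⟨fun _ => rfl, rfl⟩⟩)
    · simp only [Ctx.plug, Term.func.injEq] at h
      obtain ⟨rfl, hfg, htu⟩ := h
      obtain rfl := eq_of_heq hfg
      have htu := eq_of_heq htu
      obtain rfl | hij := eq_or_ne i j
      · have hpq : C.plug p = D.plug q := by simpa using congrFun htu i
        rcases ih D p q hpq with ⟨E, hp, hE⟩ | ⟨E, hq, hE⟩ | hdis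
        · exact Or.inl ⟨E, hp, hE.func f i htu⟩
        · exact Or.inr (Or.inl ⟨E, hq, hE.func f i htu.symm⟩)
        · refine Or.inr (Or.inr fun p' q' => ?_)
          obtain ⟨C', D', h1, h2, h3, h4, h5⟩ := hdis p' q'
          have h6 (e : L.Term X) : Function.update ts i e = Function.update us i e := by
            simpa using congrArg (fun v => Function.update v i e) htu
          refine ⟨.func f i ts C', .func f i ts D', ?_, ?_, ?_, ?_, ?_⟩ <;>
            simp only [Ctx.plug, ctxGrade, h1, h2, h3, h4, h5, h6]
      · refine Or.inr (Or.inr fun p' q' => ?_)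
        have hi : us i = C.plug p := by simpa [hij] using (congrFun htu i).symm
        have hj : ts j = D.plug q := by simpa [hij.symm] using congrFun htu j
        refine ⟨.func f i (Function.update us j (D.plug q')) C,
          .func f j (Function.update ts i (C.plug p')) D, ?_, ?_, ?_, rfl, rfl⟩
        · rw [Ctx.plug, Ctx.plug, ← hj, Function.update_comm hij, Function.update_eq_self]
        · rw [Ctx.plug, Ctx.plug, ← hi, Function.update_comm hij.symm, Function.update_eq_self]
        · simp only [Ctx.plug, Term.func.injEq, heq_eq_eq, true_and]
          have := congrArg
            (fun v => Function.update (Function.update v i (C.plug p')) j (D.plug q')) htu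
          simp only [Function.update_idem] at this
          rw [this, Function.update_comm hij, Function.update_idem]

/-- A position of an instance `a^τ` is either the position of a subterm `u` of `a` that is not a
variable, or it lies below the position of a variable `x` of `a`. -/
theorem position_in_instance (τ : X → L.Term X) (E : Ctx L X) : ∀ (a r : L.Term X),
    E.plug r = a.subst τ →
    (∃ (F : Ctx L X) (u : L.Term X), a = F.plug u ∧ (∀ x, u ≠ .var x) ∧ u.subst τ = r ∧
      T.IsBelow E (F.subst τ) .hole) ∨
    ∃ (F : Ctx L X) (x : X) (G : Ctx L X), a = F.plug (.var x) ∧ G.plug r = τ x ∧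
      T.IsBelow E (F.subst τ) G := by
  induction E with
  | hole =>
    rintro (x | ⟨f, ts⟩) r h
    · exact Or.inr ⟨.hole, x, .hole, rfl, h, ⟨fun _ => rfl, rfl⟩⟩
    · exact Or.inl ⟨.hole, .func f ts, rfl, fun _ => by simp, h.symm, ⟨fun _ => rfl, rfl⟩⟩
  | @func n f i ts E ih =>
    rintro (x | ⟨g, as⟩) r h
    · exact Or.inr ⟨.hole, x, .func f i ts E, rfl, h, ⟨fun _ => rfl, rfl⟩⟩
    · simp only [Ctx.plug, Term.subst, Term.func.injEq] at h
      obtain ⟨rfl, hfg, hts⟩ := h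
      obtain rfl := eq_of_heq hfg
      have hts := eq_of_heq hts
      have hi : E.plug r = (as i).subst τ := by simpa using congrFun hts i
      have hup : Function.update (fun j => (as j).subst τ) i (E.plug r) =
          Function.update ts i (E.plug r) := by rw [← hts, Function.update_idem]
      rcases ih (as i) r hi with ⟨F, u, h1, h2, h3, h4⟩ | ⟨F, x, G, h1, h2, h3⟩
      · refine Or.inl ⟨.func f i as F, u, ?_, h2, h3, h4.func f i hup⟩
        rw [Ctx.plug, ← h1, Function.update_eq_self]
      · refine Or.inr ⟨.func f i as F, x, G, ?_, h2, h3.func f i hup⟩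
        rw [Ctx.plug, ← h1, Function.update_eq_self]

end GradedTRS

end Contexts

/-! ### Lawverian quantales and change of base -/

section Quantales

variable {Ω : Type*} [CommMonoid Ω] [CompleteLattice Ω]

theorem IsLawverian.le_one [IsQuantale Ω] [IsLawverian Ω] (x : Ω) : x ≤ 1 :=
  le_top.trans_eq IsLawverian.one_eq_top.symm

theorem prod_le_factor [IsQuantale Ω] [IsLawverian Ω] {ι : Type*} [Fintype ι] (f : ι → Ω) (i : ι) :
    ∏ j, f j ≤ f i := by
  classical
  rw [← Finset.mul_prod_erase _ f (Finset.mem_univ i)]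
  exact mul_le_of_le_one_right' (IsLawverian.le_one _)

/-- A change of base endofunctor may send `⊥` to any element, but the members `⊥` of a join other
than `⊥` can be left out, so that only the images of the other members matter. -/
theorem IsCBE.map_iSup_le {φ : Ω → Ω} (hφ : IsCBE φ) {ι : Sort*} {f : ι → Ω} {y : Ω}
    (hne : ⨆ i, f i ≠ ⊥) (hle : ∀ i, f i ≠ ⊥ → φ (f i) ≤ y) : φ (⨆ i, f i) ≤ y := by
  rw [iSup, ← sSup_sdiff_singleton_bot, hφ.map_sSup]
  · refine sSup_le ?_
    rintro _ ⟨_, ⟨⟨i, rfl⟩, hi⟩, rfl⟩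
    exact hle i hi
  · rw [Set.nonempty_iff_ne_empty]
    intro h
    rw [iSup, ← sSup_sdiff_singleton_bot, h, sSup_empty] at hne
    exact hne rfl

end Quantales

/-! ### Joinability and Newman's lemma for `Ω`-relations -/

namespace QRel

variable {Ω A : Type*} [CommMonoid Ω] [CompleteLattice Ω]

/-- The degree `(R* ; R*⁻)(a, b)` to which `a` and `b` have a common reduct. -/
noncomputable def join (R : A → A → Ω) (a b : A) : Ω := ⨆ c, star R a c * star R b c

theorem mul_star_le_join (R : A → A → Ω) (a b c : A) : star R a c * star R b c ≤ join R a b :=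
  le_iSup (fun c => star R a c * star R b c) c

theorem join_comm (R : A → A → Ω) (a b : A) : join R a b = join R b a := by
  simp only [join, mul_comm]

theorem one_le_star (R : A → A → Ω) (a : A) : 1 ≤ star R a a :=
  le_iSup_of_le 0 (by simp [iter, diag])

theorem iter_zero_self (R : A → A → Ω) (a : A) : iter R 0 a a = 1 := if_pos rfl

theorem iter_zero_of_ne (R : A → A → Ω) {a b : A} (h : a ≠ b) : iter R 0 a b = ⊥ := if_neg h

theorem le_star (R : A → A → Ω) (a b : A) : R a b ≤ star R a b := by
  refine le_iSup_of_le 1 (le_iSup_of_le b ?_)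
  simp [iter, diag]

variable [IsQuantale Ω]

theorem iter_mul_iter_le (R : A → A → Ω) (n m : ℕ) (a b c : A) :
    iter R n a b * iter R m b c ≤ iter R (n + m) a c := by
  induction n generalizing a with
  | zero =>
    by_cases h : a = b
    · subst h
      simp [iter, diag]
    · simp [iter, diag, h]
  | succ n ih =>
    rw [Nat.succ_add]
    simp only [iter, comp, Quantale.iSup_mul_distrib]
    refine iSup_mono fun d => ?_
    rw [mul_assoc]
    gcongr
    exact ih d

theorem star_mul_star_le (R : A → A → Ω) (a b c : A) :
    star R a b * star R b c ≤ star R a c := by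
  simp only [star, Quantale.iSup_mul_distrib, Quantale.mul_iSup_distrib]
  exact iSup_le fun m => iSup_le fun n => le_iSup_of_le (n + m) (iter_mul_iter_le R n m a b c)

theorem one_le_join (R : A → A → Ω) (a : A) : 1 ≤ join R a a := by
  refine le_trans ?_ (mul_star_le_join R a a a)
  calc (1 : Ω) = 1 * 1 := (one_mul 1).symm
    _ ≤ _ := mul_le_mul' (one_le_star R a) (one_le_star R a)

theorem star_le_join (R : A → A → Ω) (a b : A) : star R a b ≤ join R a b := by
  refine le_trans ?_ (mul_star_le_join R a b b)
  calc star R a b = star R a b * 1 := (mul_one _).symm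
    _ ≤ _ := mul_le_mul_right (one_le_star R b) _

theorem star_mul_join_le (R : A → A → Ω) (a b c : A) :
    star R a b * join R b c ≤ join R a c := by
  rw [join, Quantale.mul_iSup_distrib]
  refine iSup_le fun d => ?_
  rw [← mul_assoc]
  exact (mul_le_mul_left (star_mul_star_le R a b d) _).trans (mul_star_le_join R a c d)

/-- Newman's lemma for `Ω`-relations: the well-founded induction runs along the pairs with
`R a b ≠ ⊥`, since the other pairs contribute nothing to a composite. -/
theorem LocallyConfluent.confluent {R : A → A → Ω} (hloc : LocallyConfluent R)
    (hterm : Terminating R) : Confluent R := by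
  have hwf : WellFounded fun b a => R a b ≠ ⊥ := by
    rw [wellFounded_iff_isEmpty_descending_chain]
    exact ⟨fun u => hterm ⟨u.1, u.2⟩⟩
  have hpeak (a b c : A) : R a b * R a c ≤ join R b c :=
    (le_iSup (fun a => R a b * R a c) a).trans (hloc b c)
  suffices h : ∀ a b c, star R a b * star R a c ≤ join R b c from
    fun b c => iSup_le fun a => h a b c
  intro a
  induction a using hwf.induction with
  | _ a ih =>
    intro b c
    simp only [star, Quantale.iSup_mul_distrib, Quantale.mul_iSup_distrib]
    refine iSup_le fun m => iSup_le fun n => ?_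
    -- one of the reductions is empty, or both start with a step
    obtain _ | n := n
    · by_cases h : a = b
      · subst h
        rw [iter_zero_self, one_mul]
        exact (le_iSup (fun n => iter R n a c) m).trans (star_le_join R a c)
      · simp [iter_zero_of_ne R h]
    obtain _ | m := m
    · by_cases h : a = c
      · subst h
        rw [iter_zero_self, mul_one, join_comm]
        exact (le_iSup (fun n => iter R n a b) (n + 1)).trans (star_le_join R a b)
      · simp [iter_zero_of_ne R h]
    rw [iter, iter, comp, comp, Quantale.iSup_mul_distrib]
    refine iSup_le fun b' => ?_
    rw [Quantale.mul_iSup_distrib]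
    refine iSup_le fun c' => ?_
    by_cases hb' : R a b' = ⊥
    · simp [hb']
    by_cases hc' : R a c' = ⊥
    · simp [hc']
    calc R a b' * iter R n b' b * (R a c' * iter R m c' c)
        ≤ R a b' * star R b' b * (R a c' * star R c' c) :=
          mul_le_mul' (mul_le_mul_right (le_iSup (fun n => iter R n b' b) n) _)
            (mul_le_mul_right (le_iSup (fun n => iter R n c' c) m) _)
      _ = R a b' * R a c' * (star R b' b * star R c' c) := mul_mul_mul_comm ..
      _ ≤ join R b' c' * (star R b' b * star R c' c) := mul_le_mul_left (hpeak a b' c') _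
      _ ≤ join R b c := by
          rw [join, Quantale.iSup_mul_distrib]
          refine iSup_le fun d => ?_
          calc star R b' d * star R c' d * (star R b' b * star R c' c)
              = star R b' b * star R b' d * (star R c' d * star R c' c) := by ac_rfl
            _ ≤ join R b d * (star R c' d * star R c' c) := mul_le_mul_left (ih b' hb' b d) _
            _ ≤ join R b c := by
                rw [join, Quantale.iSup_mul_distrib]
                refine iSup_le fun e => ?_
                calc star R b e * star R d e * (star R c' d * star R c' c)
                    = star R b e * ((star R c' d * star R d e) * star R c' c) := by ac_rfl
                  _ ≤ star R b e * join R e c := by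
                      gcongr
                      exact (mul_le_mul_left (star_mul_star_le R c' d e) _).trans (ih c' hc' e c)
                  _ ≤ join R b c := star_mul_join_le R b e c

end QRel

/-! ### Graded reductions -/

namespace GradedTRS

open FirstOrder Language

variable {Ω : Type*} [CommMonoid Ω] [CompleteLattice Ω] {Φ : GradeSystem Ω}
  {L : FirstOrder.Language} {X : Type*} (T : GradedTRS Ω Φ L X)

theorem isCBE_ctxGrade (C : Ctx L X) : IsCBE (T.ctxGrade C) := by
  refine Φ.isCBE _ ?_
  induction C with
  | hole => exact Φ.id_mem
  | func f i ts C ih => exact Φ.comp_mem _ (T.grade_mem f i) _ ih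

theorem isCBE_grade {n : ℕ} (f : L.Functions n) (i : Fin n) : IsCBE (T.grade f i) :=
  Φ.isCBE _ (T.grade_mem f i)

variable {T}

theorem Step.ctx {ε : Ω} {e f : L.Term X} (h : T.Step ε e f) (C : Ctx L X) :
    T.Step (T.ctxGrade C ε) (C.plug e) (C.plug f) := by
  induction h with
  | rule h D σ =>
    have := Step.rule h (C.comp D) σ
    rwa [ctxGrade_comp, Ctx.plug_comp, Ctx.plug_comp] at this
  | weaken _ hδ ih => exact ih.weaken ((T.isCBE_ctxGrade C).mono hδ)

theorem Step.subst {ε : Ω} {e f : L.Term X} (h : T.Step ε e f) (σ : X → L.Term X) :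
    T.Step ε (e.subst σ) (f.subst σ) := by
  induction h with
  | rule h D τ =>
    have := Step.rule h (D.subst σ) fun x => (τ x).subst σ
    rwa [ctxGrade_subst, ← subst_subst, ← subst_subst, ← Ctx.plug_subst, ← Ctx.plug_subst] at this
  | weaken _ hδ ih => exact ih.weaken hδ

theorem Step.exists_rule {ε : Ω} {e f : L.Term X} (h : T.Step ε e f) :
    ∃ (δ : Ω) (a b : L.Term X) (C : Ctx L X) (σ : X → L.Term X), T.rule δ a b ∧
      ε ≤ T.ctxGrade C δ ∧ e = C.plug (a.subst σ) ∧ f = C.plug (b.subst σ) := by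
  induction h with
  | rule h C σ => exact ⟨_, _, _, C, σ, h, le_rfl, rfl, rfl⟩
  | weaken _ hδ ih =>
    obtain ⟨δ, a, b, C, σ, h, hle, he, hf⟩ := ih
    exact ⟨δ, a, b, C, σ, h, hδ.trans hle, he, hf⟩

theorem Step.le_R {ε : Ω} {e f : L.Term X} (h : T.Step ε e f) : ε ≤ T.R e f := le_sSup h

variable (T)

theorem R_le_R_subst (e f : L.Term X) (σ : X → L.Term X) :
    T.R e f ≤ T.R (e.subst σ) (f.subst σ) :=
  sSup_le_sSup fun _ h => Step.subst h σ

theorem ctxGrade_R_le {e f : L.Term X} (h : T.R e f ≠ ⊥) (C : Ctx L X) :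
    T.ctxGrade C (T.R e f) ≤ T.R (C.plug e) (C.plug f) := by
  rw [R, sSup_eq_iSup'] at h ⊢
  exact (T.isCBE_ctxGrade C).map_iSup_le h fun ε _ => (Step.ctx ε.2 C).le_R

/-- A multi-step reduction `η ⊩ e →* f`, whose grade is the tensor of the grades of its steps. In
contrast to the closure `R*` it passes into contexts without any condition on `⊥`. -/
inductive MultiStep : Ω → L.Term X → L.Term X → Prop
  | refl (e : L.Term X) : MultiStep 1 e e
  | tail {ε η : Ω} {e f g : L.Term X} (h : MultiStep η e f) (h' : T.Step ε f g) :
      MultiStep (η * ε) e g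

variable {T}

theorem Step.multiStep {ε : Ω} {e f : L.Term X} (h : T.Step ε e f) : T.MultiStep ε e f := by
  simpa using (MultiStep.refl e).tail h

theorem MultiStep.trans {η μ : Ω} {e f g : L.Term X} (h : T.MultiStep η e f)
    (h' : T.MultiStep μ f g) : T.MultiStep (η * μ) e g := by
  induction h' with
  | refl _ => simpa using h
  | tail _ hs ih =>
    rw [← mul_assoc]
    exact (ih h).tail hs

theorem MultiStep.ctx {η : Ω} {e f : L.Term X} (h : T.MultiStep η e f) (C : Ctx L X) :
    T.MultiStep (T.ctxGrade C η) (C.plug e) (C.plug f) := by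
  induction h with
  | refl _ =>
    rw [(T.isCBE_ctxGrade C).map_one]
    exact .refl _
  | tail _ hs ih =>
    rw [(T.isCBE_ctxGrade C).map_mul]
    exact ih.tail (hs.ctx C)

/-- Arguments of a function symbol are reduced one after the other. -/
theorem MultiStep.func {n : ℕ} (f : L.Functions n) {as bs : Fin n → L.Term X} {η : Fin n → Ω}
    (h : ∀ i, T.MultiStep (η i) (as i) (bs i)) :
    T.MultiStep (∏ i, T.grade f i (η i)) (.func f as) (.func f bs) := by
  suffices hs : ∀ s : Finset (Fin n),
      T.MultiStep (∏ i ∈ s, T.grade f i (η i)) (.func f as) (.func f (s.piecewise bs as)) by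
    simpa using hs Finset.univ
  intro s
  induction s using Finset.induction_on with
  | empty => simpa using MultiStep.refl (T := T) (Term.func f as)
  | insert i s hi ih =>
    rw [Finset.prod_insert hi, mul_comm, Finset.piecewise_insert]
    have hstep := (h i).ctx (.func f i (s.piecewise bs as) .hole)
    have hold : Function.update (s.piecewise bs as) i (as i) = s.piecewise bs as := by
      rw [Function.update_eq_self_iff, Finset.piecewise_eq_of_notMem _ _ _ hi]
    simp only [Ctx.plug, hold] at hstep
    exact ih.trans hstep

open Classical in
/-- A reduction of the value of one variable reduces an instance of `e` at the grade of that variable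
in `e`, since all occurrences of the variable are reduced. -/
theorem MultiStep.subst_update {η : Ω} {x : X} {τ : X → L.Term X} {q : L.Term X}
    (h : T.MultiStep η (τ x) q) (e : L.Term X) :
    T.MultiStep (T.varGrade x e η) (e.subst τ) (e.subst (Function.update τ x q)) := by
  induction e with
  | var y =>
    by_cases hy : y = x
    · subst hy
      simpa [varGrade] using h
    · simpa [varGrade, hy] using MultiStep.refl (T := T) (τ y)
  | func f ts ih => exact MultiStep.func f ih

variable (T)

/-! ### Grades of variables -/

theorem varGrade_eq_one_of_occ_eq_zero {x : X} {e : L.Term X} (h : occ x e = 0) (ε : Ω) :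
    T.varGrade x e ε = 1 := by
  induction e with
  | var y =>
    have hy : y ≠ x := by
      rintro rfl
      exact occ_var_self_ne_zero y h
    simp [varGrade, hy]
  | func f ts ih =>
    rw [varGrade]
    refine Finset.prod_eq_one fun i _ => ?_
    rw [ih i (Nat.le_zero.1 ((occ_le_occ_func x f ts i).trans_eq h)), (T.isCBE_grade f i).map_one]

theorem varGrade_plug_var_of_linear (F : Ctx L X) (x : X) (h : IsLinearTerm (F.plug (.var x)))
    (ε : Ω) : T.varGrade x (F.plug (.var x)) ε = T.ctxGrade F ε := by
  induction F with
  | hole => simp [Ctx.plug, varGrade, ctxGrade]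
  | func f i ts F ih =>
    rw [Ctx.plug] at h
    have hF := h.arg i
    rw [Function.update_self] at hF
    rw [Ctx.plug, varGrade]
    dsimp only
    rw [Finset.prod_eq_single i, Function.update_self, ih hF]
    · rfl
    · intro j _ hj
      rw [varGrade_eq_one_of_occ_eq_zero, (T.isCBE_grade f j).map_one]
      by_contra hne
      refine hj (h.arg_unique hne ?_)
      rw [Function.update_self]
      have := occ_le_occ_plug x F (.var x)
      have := occ_var_self_ne_zero (L := L) x
      omega
    · simp

theorem varGrade_plug_var_le [IsQuantale Ω] [IsLawverian Ω] (F : Ctx L X) (x : X) (ε : Ω) :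
    T.varGrade x (F.plug (.var x)) ε ≤ T.ctxGrade F ε := by
  induction F with
  | hole => simp [Ctx.plug, varGrade, ctxGrade]
  | func f i ts F ih =>
    rw [Ctx.plug, varGrade]
    refine (prod_le_factor _ i).trans ?_
    rw [Function.update_self]
    exact (T.isCBE_grade f i).mono ih

/-! ### Joins in contexts and instances -/

variable {T}

variable [IsQuantale Ω]

theorem MultiStep.le_star {η : Ω} {e f : L.Term X} (h : T.MultiStep η e f) :
    η ≤ QRel.star T.R e f := by
  induction h with
  | refl e => exact QRel.one_le_star T.R e
  | tail _ hs ih =>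
    exact (mul_le_mul' ih (hs.le_R.trans (QRel.le_star T.R _ _))).trans
      (QRel.star_mul_star_le T.R _ _ _)

theorem MultiStep.mul_le_join {η μ : Ω} {e f g : L.Term X} (h : T.MultiStep η e g)
    (h' : T.MultiStep μ f g) : η * μ ≤ QRel.join T.R e f :=
  (mul_le_mul' h.le_star h'.le_star).trans (QRel.mul_star_le_join T.R e f g)

variable (T)

theorem iter_le_iter_subst (n : ℕ) (e f : L.Term X) (σ : X → L.Term X) :
    QRel.iter T.R n e f ≤ QRel.iter T.R n (e.subst σ) (f.subst σ) := by
  induction n generalizing e with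
  | zero =>
    by_cases h : e = f
    · simp [QRel.iter, QRel.diag, h]
    · simp [QRel.iter, QRel.diag, h]
  | succ n ih =>
    exact iSup_le fun g => le_iSup_of_le (g.subst σ) (mul_le_mul' (T.R_le_R_subst e g σ) (ih g))

theorem join_le_join_subst (e f : L.Term X) (σ : X → L.Term X) :
    QRel.join T.R e f ≤ QRel.join T.R (e.subst σ) (f.subst σ) :=
  iSup_le fun g => le_iSup_of_le (g.subst σ) <|
    mul_le_mul' (iSup_mono fun n => T.iter_le_iter_subst n e g σ)
      (iSup_mono fun n => T.iter_le_iter_subst n f g σ)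

theorem ctxGrade_iter_le (n : ℕ) {e f : L.Term X} (h : QRel.iter T.R n e f ≠ ⊥) (C : Ctx L X) :
    T.ctxGrade C (QRel.iter T.R n e f) ≤ QRel.iter T.R n (C.plug e) (C.plug f) := by
  have hC := T.isCBE_ctxGrade C
  induction n generalizing e with
  | zero =>
    obtain rfl : e = f := by
      by_contra hne
      simp [QRel.iter, QRel.diag, hne] at h
    simp [QRel.iter, QRel.diag, hC.map_one]
  | succ n ih =>
    refine hC.map_iSup_le h fun g hg => ?_
    rw [hC.map_mul]
    exact le_iSup_of_le (C.plug g) (mul_le_mul'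
      (T.ctxGrade_R_le (fun h0 => hg (by simp [h0])) C) (ih fun h0 => hg (by simp [h0])))

theorem ctxGrade_star_le {e f : L.Term X} (h : QRel.star T.R e f ≠ ⊥) (C : Ctx L X) :
    T.ctxGrade C (QRel.star T.R e f) ≤ QRel.star T.R (C.plug e) (C.plug f) :=
  (T.isCBE_ctxGrade C).map_iSup_le h fun n hn => le_iSup_of_le n (T.ctxGrade_iter_le n hn C)

theorem ctxGrade_join_le {e f : L.Term X} (h : QRel.join T.R e f ≠ ⊥) (C : Ctx L X) :
    T.ctxGrade C (QRel.join T.R e f) ≤ QRel.join T.R (C.plug e) (C.plug f) := by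
  refine (T.isCBE_ctxGrade C).map_iSup_le h fun g hg => ?_
  rw [(T.isCBE_ctxGrade C).map_mul]
  exact le_iSup_of_le (C.plug g) (mul_le_mul'
    (T.ctxGrade_star_le (fun h0 => hg (by simp [h0])) C)
    (T.ctxGrade_star_le (fun h0 => hg (by simp [h0])) C))

end GradedTRS

/-! ### Peaks of two rewrite steps -/

section Peaks

open FirstOrder Language

variable {L : FirstOrder.Language} {X : Type*}

theorem Ctx.subst_subst (C : Ctx L X) (σ τ : X → L.Term X) :
    (C.subst σ).subst τ = C.subst fun x => (σ x).subst τ := by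
  induction C with
  | hole => rfl
  | func f i ts C ih => simp only [Ctx.subst, ih, _root_.subst_subst]

theorem relabel_eq_subst (e : L.Term X) (g : X → X) : e.relabel g = e.subst (Term.var ∘ g) := by
  rw [← subst_relabel, subst_var]

theorem Ctx.plug_subst_congr {σ τ : X → L.Term X} {F : Ctx L X} {e : L.Term X}
    (h : ∀ x, occ x (F.plug e) ≠ 0 → σ x = τ x) (r : L.Term X) :
    (F.subst σ).plug r = (F.subst τ).plug r := by
  induction F with
  | hole => rfl
  | func f i ts F ih =>
    simp only [Ctx.subst, Ctx.plug, Term.func.injEq, heq_eq_eq, true_and]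
    rw [ih fun x hx => h x (occ_func_ne_zero.2 ⟨i, by rwa [Function.update_self]⟩)]
    funext j
    obtain rfl | hj := eq_or_ne j i
    · simp
    · rw [Function.update_of_ne hj, Function.update_of_ne hj]
      exact subst_eq_subst_iff.2 fun x hx =>
        h x (occ_func_ne_zero.2 ⟨j, by rwa [Function.update_of_ne hj]⟩)

open Classical in
theorem subst_update_of_linear {F : Ctx L X} {x : X} (h : IsLinearTerm (F.plug (.var x)))
    (τ : X → L.Term X) (q : L.Term X) :
    (F.plug (.var x)).subst (Function.update τ x q) = (F.subst τ).plug q := by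
  induction F with
  | hole => exact Function.update_self ..
  | func f i ts F ih =>
    rw [Ctx.plug] at h
    have hF := h.arg i
    rw [Function.update_self] at hF
    simp only [Ctx.subst, Ctx.plug, Term.subst, Term.func.injEq, heq_eq_eq, true_and]
    funext j
    obtain rfl | hj := eq_or_ne j i
    · rw [Function.update_self, Function.update_self, ih hF]
    · rw [Function.update_of_ne hj, Function.update_of_ne hj]
      refine subst_eq_subst_iff.2 fun y hy => Function.update_of_ne ?_ _ _
      rintro rfl
      refine hj (h.arg_unique (by rwa [Function.update_of_ne hj]) ?_)
      rw [Function.update_self]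
      have := occ_le_occ_plug y F (.var y)
      have := occ_var_self_ne_zero (L := L) y
      omega

end Peaks

namespace GradedTRS

open FirstOrder Language

variable {Ω : Type*} [CommMonoid Ω] [CompleteLattice Ω] [IsQuantale Ω] {Φ : GradeSystem Ω}
  {L : FirstOrder.Language} {X : Type*} {T : GradedTRS Ω Φ L X}

/-- A redex below a variable `x` of the left-hand side of a rule: the value of `x` is reduced
everywhere. By linearity this leaves an instance of the left-hand side, and by balance the reductions
in the right-hand side have the grade of the given one. -/
theorem variable_overlap_le_join {a b : L.Term X} {δ ε : Ω} (h : T.rule δ a b)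
    (hlin : IsLinearTerm a) (hbal : ∀ x, T.varGrade x a = T.varGrade x b) {τ : X → L.Term X}
    {E F G : Ctx L X} {x : X} {p q : L.Term X} (ha : a = F.plug (.var x)) (hG : G.plug p = τ x)
    (hE : T.IsBelow E (F.subst τ) G) (hpq : T.Step ε p q) (C : Ctx L X) :
    T.ctxGrade C (T.ctxGrade E ε) * T.ctxGrade C δ ≤
      QRel.join T.R (C.plug (E.plug q)) (C.plug (b.subst τ)) := by
  classical
  have hleft : E.plug q = a.subst (Function.update τ x (G.plug q)) := by
    rw [hE.plug_eq, ha, subst_update_of_linear (ha ▸ hlin)]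
  have hgrade : T.ctxGrade E ε = T.varGrade x b (T.ctxGrade G ε) := by
    rw [← hbal, ha, varGrade_plug_var_of_linear T F x (ha ▸ hlin), hE.grade_eq, ctxGrade_subst]
    rfl
  have hright := (MultiStep.subst_update (hG ▸ (hpq.ctx G).multiStep) b).ctx C
  rw [hleft, hgrade, mul_comm]
  exact (Step.rule h C _).multiStep.mul_le_join hright

/-- A redex at the position of a subterm `u` of the left-hand side `F[u]` of a rule that is not a
variable: the peak is an instance of a critical pair, unless both rules are variants of each other
applied at the root, in which case both results coincide. -/
theorem critical_overlap [Infinite X] (hleft : T.LeftLinear) (hextra : T.NoExtraVariables)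
    (hcrit : ∀ t s, T.IsCriticalPair t s → QRel.LocallyConfluentAt T.R t s)
    {a₁ b₁ a₂ b₂ u : L.Term X} {F : Ctx L X} {σ τ : X → L.Term X} {ε₀ δ₀ : Ω}
    (h₁ : T.rule ε₀ a₁ b₁) (h₂ : T.rule δ₀ a₂ b₂) (ha₂ : a₂ = F.plug u) (hu : ∀ x, u ≠ .var x)
    (hunif : u.subst τ = a₁.subst σ) :
    (F = .hole ∧ b₁.subst σ = b₂.subst τ) ∨
    ∀ ε δ, T.rule ε a₁ b₁ → T.rule δ a₂ b₂ → T.ctxGrade F ε * δ ≤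
      QRel.join T.R ((F.subst τ).plug (b₁.subst σ)) (b₂.subst τ) := by
  classical
  -- the second rule is renamed by `π` away from the first one, and `θ` combines `σ` and `τ`
  obtain ⟨π, hπ⟩ := exists_perm_disjoint (finite_setOf_occ_ne_zero a₁) (finite_setOf_occ_ne_zero a₂)
  let θ : X → L.Term X := fun x => if occ x a₁ ≠ 0 then σ x else τ (π.symm x)
  have hθ₁ (x) (hx : occ x a₁ ≠ 0) : θ x = σ x := if_pos hx
  have hθ₂ (x) (hx : occ x a₂ ≠ 0) : θ (π x) = τ x := by
    have : θ (π x) = τ (π.symm (π x)) := if_neg (hπ x hx)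
    rwa [Equiv.symm_apply_apply] at this
  have hθa₁ : a₁.subst θ = a₁.subst σ := subst_eq_subst_iff.2 hθ₁
  have hθb₁ : b₁.subst θ = b₁.subst σ :=
    subst_eq_subst_iff.2 fun x hx => hθ₁ x (hextra _ _ _ h₁ x hx)
  have hθb₂ : b₂.subst (θ ∘ π) = b₂.subst τ :=
    subst_eq_subst_iff.2 fun x hx => hθ₂ x (hextra _ _ _ h₂ x hx)
  have huF (x) (hx : occ x u ≠ 0) : occ x a₂ ≠ 0 := by
    have := occ_le_occ_plug x F u
    rw [← ha₂] at this
    omega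
  have hθu : u.subst (θ ∘ π) = u.subst τ := subst_eq_subst_iff.2 fun x hx => hθ₂ x (huF x hx)
  let F' := F.subst (Term.var ∘ π)
  have hc₂ : a₂.relabel π = F'.plug (u.relabel π) := by
    rw [relabel_eq_subst, relabel_eq_subst, ha₂, Ctx.plug_subst]
  have hdisj (x) (h1 : occ x a₁ ≠ 0) : occ x (a₂.relabel π) = 0 := by
    by_contra h2
    rw [occ_relabel] at h2
    exact hπ _ h2 (by simpa using h1)
  have hlinu : IsLinearTerm u := fun x =>
    (occ_le_occ_plug x F u).trans (ha₂ ▸ hleft _ _ _ h₂ x)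
  obtain ⟨μ, hμ, hmgu⟩ := exists_mgu_of_linear a₁ (u.relabel π) (hleft _ _ _ h₁)
    (hlinu.relabel π)
    (fun x hx => by
      have h0 := hdisj x hx
      by_contra h1
      rw [occ_relabel] at h0 h1
      exact huF _ h1 h0)
    ⟨θ, by rw [subst_relabel, hθu, hunif, hθa₁]⟩
  have hθμ := hmgu θ (by rw [subst_relabel, hθu, hunif, hθa₁])
  have hsubst (e : L.Term X) : (e.subst μ).subst θ = e.subst θ := by
    rw [subst_subst, ← funext hθμ]
  by_cases hvar : F' = .hole ∧
      ∃ ρ : Equiv.Perm X, a₂.relabel π = a₁.relabel ρ ∧ b₂.relabel π = b₁.relabel ρ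
  · obtain ⟨hF', ρ, hρa, hρb⟩ := hvar
    have hF : F = .hole := by
      cases F with
      | hole => rfl
      | func f i ts C => simp [F', Ctx.subst] at hF'
    refine Or.inl ⟨hF, ?_⟩
    -- on the variables of `a₁` the substitutions `θ` and `θ ∘ ρ` agree, as `a₁θ = a₂(θ ∘ π)`
    have ha : a₁.subst θ = a₁.subst (θ ∘ ρ) := by
      rw [← subst_relabel a₁ ρ, ← hρa, subst_relabel, hθa₁, ← hunif, ha₂, hF]
      exact hθu.symm
    have hb : b₁.subst θ = b₁.subst (θ ∘ ρ) :=
      subst_eq_subst_iff.2 fun x hx => subst_eq_subst_iff.1 ha x (hextra _ _ _ h₁ x hx)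
    rw [← hθb₁, hb, ← subst_relabel, ← hρb, subst_relabel, hθb₂]
  · refine Or.inr fun ε δ h₁' h₂' => ?_
    have hcp : T.IsCriticalPair ((F'.subst μ).plug (b₁.subst μ)) ((b₂.relabel π).subst μ) := by
      refine ⟨ε, δ, a₁, b₁, a₂, b₂, Equiv.refl X, π, a₁, b₁, _, _, h₁', h₂',
        (Term.relabel_id a₁).symm, (Term.relabel_id b₁).symm, rfl, rfl, ?_, F', u.relabel π, μ, hc₂,
        ?_, ⟨hμ, fun τ' hτ' => ⟨τ', hmgu τ' hτ'⟩⟩, fun hF' hρ => hvar ⟨hF', hρ⟩, rfl, rfl⟩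
      · rintro x ⟨hx₁, hx₂⟩
        have hx₁ : occ x a₁ ≠ 0 := hx₁.elim id (hextra _ _ _ h₁ x)
        refine hx₂.elim (· (hdisj x hx₁)) fun hx => ?_
        rw [occ_relabel] at hx
        refine hextra _ _ _ h₂ _ hx ?_
        rw [← occ_relabel]
        exact hdisj x hx₁
      · intro x hx
        cases u with
        | var y => exact hu y rfl
        | func f ts => simp [Term.relabel] at hx
    have hpeak : T.ctxGrade F ε * δ ≤
        QRel.join T.R ((F'.subst μ).plug (b₁.subst μ)) ((b₂.relabel π).subst μ) := by
      refine le_trans ?_ (hcrit _ _ hcp)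
      refine le_iSup_of_le ((a₂.relabel π).subst μ) (mul_le_mul' ?_ ?_)
      · have := (Step.rule h₁' (F'.subst μ) μ).le_R
        rwa [ctxGrade_subst, ctxGrade_subst, hμ, ← Ctx.plug_subst F', ← hc₂] at this
      · have := (Step.rule h₂' .hole (μ ∘ π)).le_R
        rwa [← subst_relabel, ← subst_relabel] at this
    refine (hpeak.trans (T.join_le_join_subst _ _ θ)).trans_eq ?_
    rw [Ctx.plug_subst, hsubst, hsubst, subst_relabel, hθb₁, hθb₂, Ctx.subst_subst, Ctx.subst_subst]
    congr 1
    refine Ctx.plug_subst_congr (e := u) (fun x hx => ?_) _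
    rw [← ha₂] at hx
    change ((Term.var (π x)).subst fun y => (μ y).subst θ) = τ x
    rw [← hθ₂ x hx, hθμ (π x)]
    rfl

variable [IsLawverian Ω]

/-- A bound for a peak passes into contexts. If the bound is `⊥`, then, by cointegrality, one of the
two rules yields only the distance `⊥`, which contexts preserve. -/
theorem BotStable.peak_le_join (hbot : T.BotStable) {a₁ b₁ a₂ b₂ s t : L.Term X} {F : Ctx L X}
    (hpeak : ∀ ε δ, T.rule ε a₁ b₁ → T.rule δ a₂ b₂ → T.ctxGrade F ε * δ ≤ QRel.join T.R t s)
    {ε δ : Ω} (h₁ : T.rule ε a₁ b₁) (h₂ : T.rule δ a₂ b₂) (C : Ctx L X) :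
    T.ctxGrade C (T.ctxGrade F ε) * T.ctxGrade C δ ≤
      QRel.join T.R (C.plug t) (C.plug s) := by
  by_cases hne : QRel.join T.R t s = ⊥
  · by_cases hF : ∀ ε, T.rule ε a₁ b₁ → T.ctxGrade F ε = ⊥
    · rw [hbot a₁ b₁ C F hF ε h₁, Quantale.bot_mul]
      exact bot_le
    · push Not at hF
      obtain ⟨ε', h', hε'⟩ := hF
      have h0 : ∀ δ, T.rule δ a₂ b₂ → T.ctxGrade (Ctx.hole : Ctx L X) δ = ⊥ := fun δ hδ =>
        (IsLawverian.eq_bot_or_eq_bot _ _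
          (le_bot_iff.1 ((hpeak ε' δ h' hδ).trans_eq hne))).resolve_left hε'
      have := hbot a₂ b₂ C .hole h0 δ h₂
      rw [ctxGrade, id] at this
      rw [this, Quantale.mul_bot]
      exact bot_le
  · rw [← (T.isCBE_ctxGrade C).map_mul]
    exact ((T.isCBE_ctxGrade C).mono (hpeak ε δ h₁ h₂)).trans (T.ctxGrade_join_le hne C)

/-- Two steps whose redexes are nested, the redex of the first rule inside that of the second one,
are joinable. -/
theorem nested_peak_le_join [Infinite X] (hbal : T.Balanced) (hleft : T.LeftLinear)
    (hbot : T.BotStable) (hextra : T.NoExtraVariables)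
    (hcrit : ∀ t s, T.IsCriticalPair t s → QRel.LocallyConfluentAt T.R t s)
    {a₁ b₁ a₂ b₂ : L.Term X} {C D E : Ctx L X} {σ τ : X → L.Term X} {ε δ : Ω}
    (h₁ : T.rule ε a₁ b₁) (h₂ : T.rule δ a₂ b₂) (hE : a₂.subst τ = E.plug (a₁.subst σ))
    (hD : T.IsBelow D C E) :
    T.ctxGrade D ε * T.ctxGrade C δ ≤
      QRel.join T.R (D.plug (b₁.subst σ)) (C.plug (b₂.subst τ)) := by
  rw [hD.plug_eq, hD.grade_eq, Function.comp_apply]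
  rcases T.position_in_instance τ E a₂ _ hE.symm with
    ⟨F, u, ha₂, hu, huσ, hF⟩ | ⟨F, x, G, ha₂, hG, hF⟩
  · have hgrade : T.ctxGrade E = T.ctxGrade F := by
      rw [hF.grade_eq, ctxGrade_subst]
      rfl
    rw [hF.plug_eq, hgrade]
    rcases critical_overlap hleft hextra hcrit h₁ h₂ ha₂ hu huσ with ⟨rfl, heq⟩ | hle
    · rw [← heq]
      exact (IsLawverian.le_one _).trans (QRel.one_le_join T.R _)
    · exact hbot.peak_le_join hle h₁ h₂ C
  · exact variable_overlap_le_join h₂ (hleft _ _ _ h₂) (hbal _ _ _ h₂) ha₂ hG hF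
      (Step.rule h₁ .hole σ) C

theorem peak_le_join [Infinite X] (hbal : T.Balanced) (hleft : T.LeftLinear)
    (hbot : T.BotStable) (hextra : T.NoExtraVariables)
    (hcrit : ∀ t s, T.IsCriticalPair t s → QRel.LocallyConfluentAt T.R t s)
    {e s t : L.Term X} {ε δ : Ω} (hs : T.Step ε e s) (ht : T.Step δ e t) :
    ε * δ ≤ QRel.join T.R s t := by
  obtain ⟨ε', a₁, b₁, C, σ, h₁, hε, rfl, rfl⟩ := hs.exists_rule
  obtain ⟨δ', a₂, b₂, D, τ, h₂, hδ, hCD, rfl⟩ := ht.exists_rule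
  refine (mul_le_mul' hε hδ).trans ?_
  rcases T.nested_or_disjoint C D _ _ hCD with ⟨E, hE, hD⟩ | ⟨E, hE, hC⟩ | hdis
  · rw [mul_comm, QRel.join_comm]
    exact nested_peak_le_join hbal hleft hbot hextra hcrit h₂ h₁ hE hD
  · exact nested_peak_le_join hbal hleft hbot hextra hcrit h₁ h₂ hE hC
  · obtain ⟨C', D', hC1, hD1, hCD', hgC, hgD⟩ := hdis (b₁.subst σ) (b₂.subst τ)
    have hs' := (Step.rule h₂ D' τ).multiStep
    have ht' := (Step.rule h₁ C' σ).multiStep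
    rw [← hC1, hgD] at hs'
    rw [← hD1, hgC, ← hCD'] at ht'
    rw [mul_comm]
    exact hs'.mul_le_join ht'

theorem locallyConfluent_of_criticalPairs [Infinite X] (hbal : T.Balanced) (hleft : T.LeftLinear)
    (hbot : T.BotStable) (hextra : T.NoExtraVariables)
    (hcrit : ∀ t s, T.IsCriticalPair t s → QRel.LocallyConfluentAt T.R t s) :
    QRel.LocallyConfluent T.R := by
  refine fun s t => iSup_le fun e => ?_
  change T.R e s * T.R e t ≤ QRel.join T.R s t
  rw [R, R, sSup_mul_distrib]
  refine iSup₂_le fun ε hε => ?_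
  rw [mul_sSup_distrib]
  exact iSup₂_le fun δ hδ => peak_le_join hbal hleft hbot hextra hcrit hε hδ

/-- If `b = F[x]` and `x` does not occur in `a`, then balance makes the grade of `F` the constant
`1`, so that `a` reduces to an instance of `F[a]`, with the distance `1` from the second
step on. -/
theorem noExtraVariables_of_terminating (hbal : T.Balanced) (hbot : T.BotStable)
    (hterm : QRel.Terminating T.R) : T.NoExtraVariables := by
  classical
  intro ε₀ a b h₀ x hxb hxa
  obtain ⟨F, hF⟩ := exists_ctx_of_occ_ne_zero hxb
  have hgrade (ε : Ω) : T.ctxGrade F ε = 1 := by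
    refine le_antisymm (IsLawverian.le_one _) ?_
    rw [← varGrade_eq_one_of_occ_eq_zero T hxa ε, hbal _ _ _ h₀ x, hF]
    exact varGrade_plug_var_le T F x ε
  -- some distance of the rule is not `⊥`, since `F` turns each distance into `1 ≠ ⊥`
  obtain ⟨ε, h, hε⟩ : ∃ ε, T.rule ε a b ∧ ε ≠ ⊥ := by
    by_contra! hall
    exact IsLawverian.one_ne_bot ((hgrade _).symm.trans (hbot a b F .hole hall ε₀ h₀))
  let τ : X → L.Term X := Function.update Term.var x a
  have ha : a.subst τ = a := by
    conv_rhs => rw [← subst_var a]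
    exact subst_eq_subst_iff.2 fun y hy =>
      Function.update_of_ne (by rintro rfl; exact hy hxa) _ _
  have hb : b.subst τ = (F.subst τ).plug a := by
    rw [hF, Ctx.plug_subst]
    congr 1
    exact Function.update_self x a Term.var
  let next : Ctx L X → Ctx L X := fun C => C.comp (F.subst τ)
  have hne (n : ℕ) : T.ctxGrade (next^[n] .hole) ε ≠ ⊥ := by
    cases n with
    | zero => exact hε
    | succ n =>
      rw [Function.iterate_succ_apply']
      simp only [next, ctxGrade_comp, ctxGrade_subst, Function.comp_apply, hgrade,
        (T.isCBE_ctxGrade _).map_one]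
      exact IsLawverian.one_ne_bot
  refine hterm ⟨fun n => (next^[n] .hole).plug a, fun n => ?_⟩
  have hstep := (Step.rule h (next^[n] .hole) τ).le_R
  rw [ha, hb, ← Ctx.plug_comp] at hstep
  simp only [Function.iterate_succ_apply']
  exact fun h0 => hne n (le_bot_iff.1 (hstep.trans_eq h0))

end GradedTRS

theorem mainTheorem4 {Ω : Type*} [CommMonoid Ω] [CompleteLattice Ω] [IsQuantale Ω] [IsLawverian Ω]
    (Φ : GradeSystem Ω) (L : FirstOrder.Language) (X : Type*) [Infinite X]
    (T : GradedTRS Ω Φ L X)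
    (hbalanced : T.Balanced) (hleft : T.LeftLinear) (hbot : T.BotStable)
    (hcrit : ∀ t s, T.IsCriticalPair t s → QRel.LocallyConfluentAt T.R t s) :
    (T.NoExtraVariables → QRel.LocallyConfluent T.R) ∧
      (QRel.Terminating T.R → QRel.Confluent T.R) := by
  have hlocal (hextra : T.NoExtraVariables) : QRel.LocallyConfluent T.R :=
    GradedTRS.locallyConfluent_of_criticalPairs hbalanced hleft hbot hextra hcrit
  exact ⟨hlocal, fun hterm =>
    (hlocal (GradedTRS.noExtraVariables_of_terminating hbalanced hbot hterm)).confluent hterm⟩
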